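/- **Notation.** For a number field $K$ let $O_K^\times$ be the unit group of its ring of integers, $F_K = O_K^\times/\mathrm{Tor}(O_K^\times)$ the free abelian group of units modulo roots of unity, and $r(K)$ the rank of $F_K$. For $\alpha \in K^\times$ let $$h(\alpha) = \sum_w \frac{[K_w:\mathbb{Q}_w]}{[K:\mathbb{Q}]}\,\log^+\|\alpha\|_w$$ be the absolute logarithmic Weil height, where $w$ runs over all places of $K$ and $\|\cdot\|_w$ extends one of the usual absolute values of $\mathbb{Q}$. Since $h$ is unchanged by multiplication by roots of unity, it is well defined on $F_K$. For number fields $k \subseteq l$ the norm induces a homomorphism $\mathrm{norm}_{l/k} : F_l \to F_k$; its kernel is the group $E_{l/k}$ of relative units. If $l/\mathbb{Q}$ is Galois, then $\mathrm{Aut}(l/\mathbb{Q})$ acts on $F_l$. If both $l/\mathbb{Q}$ and $k/\mathbb{Q}$ are Galois, an element $\gamma \in E_{l/k}$ is called a *relative Minkowski unit* for $E_{l/k}$ if the subgroup $\langle \sigma(\gamma) : \sigma \in \mathrm{Aut}(l/\mathbb{Q}) \rangle$ has rank $r(l/k) := \operatorname{rank} E_{l/k}$. **Theorem 1.2.** Let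 $\mathbb{Q} \subseteq k \subseteq l$ be number fields such that $l/\mathbb{Q}$ and $k/\mathbb{Q}$ are finite Galois extensions and $1 \le r(k) < r(l)$. Let $\eta_1, \dots, \eta_{r(l)}$ be a basis of the free abelian group $F_l$. Then $r(l/k) = r(l) - r(k)$, and the following hold. (i) If $l$ is totally real, then there exists a relative Minkowski unit $\gamma$ in $E_{l/k}$ such that $$h(\gamma) \le 4\bigl([l:k]-1\bigr)\sum_{j=1}^{r(l)} h(\eta_j).$$ (ii) If $l$ is totally complex, then there exists a relative Minkowski unit $\gamma$ in $E_{l/k}$ such that $$h(\gamma) \le 8\bigl([l:k]-1\bigr)\sum_{j=1}^{r(l)} h(\eta_j).$$ -/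

import Mathlib

set_option maxSynthPendingDepth 3

open scoped NumberField

namespace RelativeUnits

/-- `F_K = O_K^× / Tor(O_K^×)`, the unit group of `K` modulo roots of unity. -/
abbrev UnitsModTorsion (K : Type*) [Field K] [NumberField K] : Type _ :=
  (𝓞 K)ˣ ⧸ NumberField.Units.torsion K

/-- The rank `r(K)` of the free abelian group `F_K`. -/
noncomputable def unitRank (K : Type*) [Field K] [NumberField K] : ℕ :=
  Module.finrank ℤ (Additive (UnitsModTorsion K))

section Height

variable {K : Type*} [Field K] [NumberField K]

/-- The absolute logarithmic Weil height of an element `x` of the number field `K`: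
`h(x) = ∑_w ([K_w : ℚ_w] / [K : ℚ]) log⁺ ‖x‖_w`, the sum being over all places `w` of `K`.
(`Height.logHeight₁` is the same sum without the factor `1 / [K : ℚ]`.) -/
noncomputable def weilHeight (x : K) : ℝ :=
  Height.logHeight₁ x / Module.finrank ℚ K

/-- The Weil height is unchanged by multiplication by a root of unity. -/
lemma weilHeight_mul_torsion (x ζ : (𝓞 K)ˣ) (hζ : ζ ∈ NumberField.Units.torsion K) :
    weilHeight ((x * ζ : (𝓞 K)ˣ) : K) = weilHeight (x : K) := by
  have key : ∀ ξ : (𝓞 K)ˣ, ξ ∈ NumberField.Units.torsion K →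
      Height.logHeight₁ (ξ : K) = 0 := by
    intro ξ hξ
    obtain ⟨n, hn, h1⟩ := isOfFinOrder_iff_pow_eq_one.mp (show IsOfFinOrder ξ from hξ)
    have h2 : (n : ℝ) * Height.logHeight₁ (ξ : K) = 0 := by
      rw [← Height.logHeight₁_pow, ← NumberField.Units.coe_pow, h1, NumberField.Units.coe_one,
        Height.logHeight₁_one]
    have h3 : (n : ℝ) ≠ 0 := by positivity
    exact (mul_eq_zero.mp h2).resolve_left h3
  have mono : ∀ y ξ : (𝓞 K)ˣ, ξ ∈ NumberField.Units.torsion K →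
      Height.logHeight₁ ((y * ξ : (𝓞 K)ˣ) : K) ≤ Height.logHeight₁ (y : K) := by
    intro y ξ hξ
    rw [NumberField.Units.coe_mul]
    have := Height.logHeight₁_mul_le (y : K) (ξ : K)
    rw [key ξ hξ] at this
    linarith
  unfold weilHeight
  congr 1
  refine le_antisymm (mono x ζ hζ) ?_
  have := mono (x * ζ) ζ⁻¹ (inv_mem hζ)
  rwa [mul_inv_cancel_right] at this

/-- The absolute logarithmic Weil height `h` as a function on `F_K`. -/
noncomputable def height : UnitsModTorsion K → ℝ :=
  Quotient.lift (fun x : (𝓞 K)ˣ => weilHeight (x : K)) (by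
    intro x y hxy
    have h := weilHeight_mul_torsion x (x⁻¹ * y) (QuotientGroup.leftRel_apply.mp hxy)
    rw [mul_inv_cancel_left] at h
    exact h.symm)

end Height

/-- A homomorphism of unit groups maps roots of unity to roots of unity. -/
lemma torsion_le_comap {K L : Type*} [Field K] [Field L] [NumberField K] [NumberField L]
    (f : (𝓞 K)ˣ →* (𝓞 L)ˣ) :
    NumberField.Units.torsion K ≤ (NumberField.Units.torsion L).comap f :=
  fun _ hx => f.isOfFinOrder hx

/-- The action of an automorphism `σ` of `l` on `F_l`: the class of `α` goes to that of `σ α`. -/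
noncomputable def conj {l : Type*} [Field l] [NumberField l] (σ : l ≃ₐ[ℚ] l) :
    UnitsModTorsion l →* UnitsModTorsion l :=
  QuotientGroup.map _ _
    (Units.map (NumberField.RingOfIntegers.mapRingHom (σ : l →+* l) : 𝓞 l →* 𝓞 l))
    (torsion_le_comap _)

section Relative

variable (k l : Type*) [Field k] [Field l] [NumberField k] [NumberField l] [Algebra k l]

/-- The homomorphism `norm_{l/k} : F_l → F_k` induced by the field norm. -/
noncomputable def normModTorsion : UnitsModTorsion l →* UnitsModTorsion k :=
  QuotientGroup.map _ _ (Units.map (RingOfIntegers.norm k : 𝓞 l →* 𝓞 k)) (torsion_le_comap _)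

/-- The group `E_{l/k}` of relative units: the kernel of `norm_{l/k} : F_l → F_k`. -/
noncomputable def relativeUnits : Subgroup (UnitsModTorsion l) :=
  (normModTorsion k l).ker

/-- The rank `r(l/k)` of the group of relative units `E_{l/k}`. -/
noncomputable def relativeUnitRank : ℕ :=
  Module.finrank ℤ (Additive (relativeUnits k l))

variable {l} in
/-- The subgroup of `F_l` generated by the conjugates `σ γ`, `σ ∈ Aut(l/ℚ)`. -/
def conjSubgroup (γ : UnitsModTorsion l) : Subgroup (UnitsModTorsion l) :=
  Subgroup.closure (Set.range fun σ : l ≃ₐ[ℚ] l => conj σ γ)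

variable {l} in
/-- `γ` is a relative Minkowski unit for `E_{l/k}`: it lies in `E_{l/k}` and its conjugates over
`ℚ` generate a subgroup whose rank is that of `E_{l/k}`. -/
def IsRelativeMinkowskiUnit (γ : UnitsModTorsion l) : Prop :=
  γ ∈ relativeUnits k l ∧
    Module.finrank ℤ (Additive (conjSubgroup γ)) = relativeUnitRank k l

end Relative

end RelativeUnits

/-! For a unit, twice the height times the degree is the ℓ¹ norm of its full logarithmic vector, so
everything takes place in the hyperplane of vectors with coordinate sum zero.

Let S be the sum of the ℓ¹ norms of the basis vectors. By Dirichlet's theorem they span the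
hyperplane, and rounding real coefficients gives a unit β within S/2 of a spike c(e_w₀ − average).
Since Galois permutes the places transitively, the conjugates of β are equally close to the spikes
at all places. When c > S/2 this is ℓ¹ diagonal dominance, so they span the hyperplane: β is a
Minkowski unit of norm at most 2S (`exists_minkowski_unit`).

Then γ = β^[l:k] / norm β = ∏_{τ ≠ 1} β / τβ lies in the relative units and costs a factor 2([l:k] −
1) (`l1_fullLog_toRelativeUnit_le`). This map is Galois equivariant and is the [l:k]-th power on
relative units, so the conjugates of γ have full rank there
(`isRelativeMinkowskiUnit_toRelativeUnit`). -/

namespace RelativeUnits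

open NumberField Module

/-! ### ℓ¹ diagonal dominance on the sum-zero hyperplane -/

section Dominant

variable {W : Type*} [Fintype W]

/-- The hyperplane of vectors whose coordinates sum to zero. -/
def sumZero (W : Type*) [Fintype W] : Submodule ℝ (W → ℝ) where
  carrier := {x | ∑ w, x w = 0}
  zero_mem' := by simp
  add_mem' := by
    intro x y hx hy
    simp only [Set.mem_ofPred_eq] at hx hy ⊢
    simp [Finset.sum_add_distrib, hx, hy]
  smul_mem' := by
    intro c x hx
    simp only [Set.mem_ofPred_eq] at hx ⊢
    simp [← Finset.mul_sum, hx]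

lemma mem_sumZero {x : W → ℝ} : x ∈ sumZero W ↔ ∑ w, x w = 0 := Iff.rfl

lemma finrank_sumZero [Nonempty W] : finrank ℝ (sumZero W) = Fintype.card W - 1 := by
  classical
  let f : (W → ℝ) →ₗ[ℝ] ℝ := ∑ w, LinearMap.proj w
  have hf : ∀ x, f x = ∑ w, x w := fun x => by simp [f]
  have hker : sumZero W = LinearMap.ker f := by
    ext x; simp [mem_sumZero, hf]
  have hsurj : LinearMap.range f = ⊤ := by
    rw [LinearMap.range_eq_top]
    intro c
    obtain ⟨w⟩ := ‹Nonempty W›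
    exact ⟨Pi.single w c, by simp [hf]⟩
  have := f.finrank_range_add_finrank_ker
  rw [hsurj, finrank_top, finrank_self, finrank_fintype_fun_eq_card] at this
  rw [hker]
  omega

/-- The `ℓ¹` norm of a real vector. -/
def l1 (x : W → ℝ) : ℝ := ∑ w, |x w|

lemma l1_nonneg (x : W → ℝ) : 0 ≤ l1 x := Finset.sum_nonneg fun _ _ => abs_nonneg _

lemma l1_add_le (x y : W → ℝ) : l1 (x + y) ≤ l1 x + l1 y := by
  unfold l1
  rw [← Finset.sum_add_distrib]
  exact Finset.sum_le_sum fun w _ => abs_add_le _ _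

lemma l1_smul (c : ℝ) (x : W → ℝ) : l1 (c • x) = |c| * l1 x := by
  simp [l1, abs_mul, Finset.mul_sum]

lemma l1_sub_le (x y : W → ℝ) : l1 (x - y) ≤ l1 x + l1 y := by
  have h := l1_add_le x ((-1 : ℝ) • y)
  rw [l1_smul] at h
  simpa [sub_eq_add_neg] using h

lemma l1_sum_le {ι : Type*} (s : Finset ι) (x : ι → W → ℝ) :
    l1 (∑ i ∈ s, x i) ≤ ∑ i ∈ s, l1 (x i) := by
  classical
  induction s using Finset.induction_on with
  | empty => simp [l1]
  | insert i s hi ih =>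
    rw [Finset.sum_insert hi, Finset.sum_insert hi]
    exact (l1_add_le _ _).trans (by linarith)

lemma l1_eq_zero {x : W → ℝ} (h : l1 x = 0) : x = 0 := by
  ext w
  have := (Finset.sum_eq_zero_iff_of_nonneg fun w _ => abs_nonneg (x w)).mp h w (Finset.mem_univ w)
  simpa using this

/-- A family of vectors whose deviations from the projections of `c` times the standard basis
onto the hyperplane `sumZero W` are smaller than `c` spans this hyperplane. -/
lemma sumZero_le_span_of_l1_lt [DecidableEq W] {c ε : ℝ} (hε : ε < c) (hc : 0 < c)
    (v : W → W → ℝ) (hv : ∀ w, v w ∈ sumZero W)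
    (herr : ∀ w, l1 (v w - (c • (Pi.single w 1 : W → ℝ) - fun _ => c / Fintype.card W)) ≤ ε) :
    sumZero W ≤ Submodule.span ℝ (Set.range v) := by
  set err : W → W → ℝ := fun w =>
    v w - (c • (Pi.single w 1 : W → ℝ) - fun _ => c / Fintype.card W) with herrdef
  have hve : ∀ w, v w = c • (Pi.single w 1 : W → ℝ) - (fun _ => c / Fintype.card W) + err w :=
    fun w => by simp [herrdef]
  -- On the hyperplane the averaging terms cancel, so T is c times the identity plus a perturbation
  -- of ℓ¹ operator norm at most ε < c. It is therefore injective there, hence surjective by finite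
  -- dimension.
  let T : (W → ℝ) →ₗ[ℝ] (W → ℝ) := Fintype.linearCombination ℝ v
  have hT : ∀ a, T a = ∑ w, a w • v w := fun a => Fintype.linearCombination_apply ℝ v a
  have hmaps : ∀ a ∈ sumZero W, T a ∈ sumZero W := fun a _ => by
    rw [hT]; exact Submodule.sum_mem _ fun w _ => Submodule.smul_mem _ _ (hv w)
  have hTa : ∀ a ∈ sumZero W, T a = c • a + ∑ w, a w • err w := by
    intro a ha
    rw [hT]
    simp_rw [hve, smul_add, smul_sub, Finset.sum_add_distrib, Finset.sum_sub_distrib]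
    congr 1
    have h1 : ∑ w, a w • (fun _ : W => c / Fintype.card W) = 0 := by
      rw [← Finset.sum_smul, mem_sumZero.mp ha, zero_smul]
    rw [h1, sub_zero]
    ext u
    simp [Finset.sum_apply, Pi.single_apply, mul_comm]
  have hinj : Function.Injective (T.restrict hmaps) := by
    rw [injective_iff_map_eq_zero]
    rintro ⟨a, ha⟩ h0
    have h0' : T a = 0 := congrArg Subtype.val h0
    rw [hTa a ha] at h0'
    have h2 : c • a = (-1 : ℝ) • ∑ w, a w • err w := by
      rw [eq_neg_of_add_eq_zero_left h0', neg_one_smul]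
    have h3 : c * l1 a ≤ ε * l1 a := by
      calc c * l1 a = l1 (c • a) := by rw [l1_smul, abs_of_pos hc]
        _ = l1 (∑ w, a w • err w) := by rw [h2, l1_smul]; simp
        _ ≤ ∑ w, l1 (a w • err w) := l1_sum_le _ _
        _ ≤ ∑ w, |a w| * ε := Finset.sum_le_sum fun w _ => by
            rw [l1_smul]; exact mul_le_mul_of_nonneg_left (herr w) (abs_nonneg _)
        _ = ε * l1 a := by rw [← Finset.sum_mul, mul_comm]; rfl
    have h4 : l1 a = 0 := by nlinarith [l1_nonneg a]
    exact Subtype.ext (l1_eq_zero h4)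
  intro x hx
  obtain ⟨⟨a, ha⟩, h⟩ := (LinearMap.injective_iff_surjective.mp hinj) ⟨x, hx⟩
  have h' : T a = x := congrArg Subtype.val h
  rw [← h', hT]
  exact Submodule.sum_mem _ fun w _ => Submodule.smul_mem _ _ (Submodule.subset_span ⟨w, rfl⟩)

lemma l1_target [DecidableEq W] {c : ℝ} (hc : 0 < c) (w₀ : W) :
    l1 (c • (Pi.single w₀ 1 : W → ℝ) - fun _ => c / Fintype.card W) ≤ 2 * c := by
  have : Nonempty W := ⟨w₀⟩
  have hN : (0 : ℝ) < Fintype.card W := by exact_mod_cast Fintype.card_pos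
  refine (l1_sub_le _ _).trans ?_
  rw [l1_smul]
  have h1 : l1 (Pi.single w₀ 1 : W → ℝ) = 1 := by
    simp [l1, Pi.single_apply, apply_ite abs]
  have h2 : l1 (fun _ : W => c / Fintype.card W) = c := by
    simp only [l1, Finset.sum_const, Finset.card_univ, nsmul_eq_mul]
    rw [abs_of_pos (by positivity)]
    field_simp
  rw [h1, h2, abs_of_pos hc]
  linarith

end Dominant

/-! ### Logarithmic vectors, heights and the Galois action -/

section LogMap

variable {K : Type*} [Field K] [NumberField K]

/-- The logarithmic map `x ↦ (mult w * log w(x))_w` on units modulo torsion, with all infinite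
places retained. -/
noncomputable def fullLog : Additive (UnitsModTorsion K) →+ (InfinitePlace K → ℝ) :=
  MonoidHom.toAdditiveLeft <| QuotientGroup.lift (Units.torsion K)
    { toFun := fun x => Multiplicative.ofAdd fun w : InfinitePlace K => w.mult * Real.log (w (x : K))
      map_one' := by ext; simp
      map_mul' := fun x y => by
        apply Multiplicative.toAdd.injective
        ext w
        simp only [Units.coe_mul, map_mul, toAdd_ofAdd, toAdd_mul, Pi.add_apply]
        rw [Real.log_mul (by simp) (by simp), mul_add] }
    (fun x hx => by
      rw [MonoidHom.mem_ker]
      apply Multiplicative.toAdd.injective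
      ext w
      simp [(Units.mem_torsion K).mp hx w])

lemma fullLog_mk (x : (𝓞 K)ˣ) (w : InfinitePlace K) :
    fullLog (Additive.ofMul (x : UnitsModTorsion K)) w = w.mult * Real.log (w (x : K)) := rfl

lemma fullLog_mem_sumZero (x : Additive (UnitsModTorsion K)) :
    fullLog x ∈ sumZero (InfinitePlace K) := by
  obtain ⟨y, rfl⟩ := QuotientGroup.mk_surjective x.toMul
  exact Units.sum_mult_mul_log y

/-- Finite places contribute nothing for a unit. At infinite ones 2 log⁺ t = |log t| + log t, and
the weighted logarithms sum to zero by the product formula. -/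
lemma two_mul_height (x : UnitsModTorsion K) :
    2 * finrank ℚ K * height x = l1 (fullLog (Additive.ofMul x)) := by
  obtain ⟨y, rfl⟩ := QuotientGroup.mk_surjective x
  have hK : (finrank ℚ K : ℝ) ≠ 0 := by exact_mod_cast finrank_pos.ne'
  have h1 : height (y : UnitsModTorsion K) = weilHeight (y : K) := rfl
  have hfin : ∀ v : FinitePlace K, v (y : K) = 1 := fun v => by
    have hle : ∀ z : (𝓞 K)ˣ, v (z : K) ≤ 1 := fun z =>
      FinitePlace.norm_embedding_eq v (z : K) ▸ FinitePlace.norm_le_one K v.maximalIdeal (z : 𝓞 K)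
    have hmul : v (y : K) * v ((y⁻¹ : (𝓞 K)ˣ) : K) = 1 := by
      rw [← map_mul, ← Units.coe_mul, mul_inv_cancel, Units.coe_one, map_one]
    have h0 : 0 ≤ v (y : K) := apply_nonneg v _
    nlinarith [hle y, hle y⁻¹]
  have h2 : Height.logHeight₁ (y : K) = ∑ w : InfinitePlace K, w.mult * Real.posLog (w (y : K)) := by
    rw [NumberField.logHeight₁_eq]
    simp [hfin]
  have h3 : ∀ w : InfinitePlace K,
      |fullLog (Additive.ofMul (y : UnitsModTorsion K)) w| =
        2 * (w.mult * Real.posLog (w (y : K))) - fullLog (Additive.ofMul (y : UnitsModTorsion K)) w := by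
    intro w
    rw [fullLog_mk, abs_mul, Nat.abs_cast]
    have := Real.half_mul_log_add_log_abs (x := w (y : K))
    rw [← this]; ring
  rw [h1, weilHeight, l1, Finset.sum_congr rfl fun w _ => h3 w, Finset.sum_sub_distrib,
    mem_sumZero.mp (fullLog_mem_sumZero _), ← Finset.mul_sum, ← h2]
  field_simp
  ring

/-- **Dirichlet's unit theorem**: the logarithmic vectors of a basis span the hyperplane. -/
lemma exists_sum_smul_fullLog {ι : Type*} [Fintype ι]
    (η : Basis ι ℤ (Additive (UnitsModTorsion K)))
    {e : InfinitePlace K → ℝ} (he : e ∈ sumZero (InfinitePlace K)) :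
    ∃ t : ι → ℝ, ∑ j, t j • fullLog (η j) = e := by
  classical
  -- Forgetting the coordinate at the distinguished place is injective on the hyperplane, so the
  -- spanning statement for the usual unit lattice lifts back.
  let P : (InfinitePlace K → ℝ) →ₗ[ℝ] Units.dirichletUnitTheorem.logSpace K :=
    { toFun := fun x w => x w.1
      map_add' := fun _ _ => rfl
      map_smul' := fun _ _ => rfl }
  have hP : ∀ x ∈ sumZero (InfinitePlace K), P x = 0 → x = 0 := by
    intro x hx h0
    have h1 : ∀ w, w ≠ Units.dirichletUnitTheorem.w₀ → x w = 0 := fun w hw => congrFun h0 ⟨w, hw⟩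
    ext w
    by_cases hw : w = Units.dirichletUnitTheorem.w₀
    · rw [hw]
      have := mem_sumZero.mp hx
      rwa [Finset.sum_eq_single Units.dirichletUnitTheorem.w₀ (fun w _ hw => h1 w hw)
        (by simp)] at this
    · exact h1 w hw
  have hspan : (⊤ : Submodule ℝ (Units.dirichletUnitTheorem.logSpace K)) ≤
      Submodule.span ℝ (Set.range fun j => P (fullLog (η j))) := by
    rw [← Units.dirichletUnitTheorem.unitLattice_span_eq_top K, Submodule.span_le]
    intro z hz
    obtain ⟨x, rfl⟩ : ∃ x, Units.logEmbedding K x = z := by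
      obtain ⟨x, -, hx⟩ := hz
      exact ⟨x, hx⟩
    have hx : Units.logEmbedding K x =
        P (fullLog (Additive.ofMul ((x.toMul : (𝓞 K)ˣ) : UnitsModTorsion K))) := rfl
    rw [SetLike.mem_coe]
    rw [hx, ← η.sum_repr (Additive.ofMul ((x.toMul : (𝓞 K)ˣ) : UnitsModTorsion K)), map_sum,
      map_sum]
    refine Submodule.sum_mem _ fun j _ => ?_
    rw [map_zsmul, map_zsmul]
    exact zsmul_mem (Submodule.subset_span (Set.mem_range_self j)) _
  obtain ⟨t, ht⟩ := (Submodule.mem_span_range_iff_exists_fun ℝ).mp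
    (hspan (Submodule.mem_top (x := P e)))
  refine ⟨t, sub_eq_zero.mp (hP _ ?_ ?_)⟩
  · exact Submodule.sub_mem _ (Submodule.sum_mem _ fun j _ =>
      Submodule.smul_mem _ _ (fullLog_mem_sumZero _)) he
  · simp [map_sub, map_sum, ht]

lemma mult_smul (σ : K ≃ₐ[ℚ] K) (w : InfinitePlace K) : (σ • w).mult = w.mult := by
  classical
  unfold InfinitePlace.mult
  exact if_congr InfinitePlace.isReal_smul_iff rfl rfl

lemma fullLog_conj (σ : K ≃ₐ[ℚ] K) (x : UnitsModTorsion K) (w : InfinitePlace K) :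
    fullLog (Additive.ofMul (conj σ x)) w = fullLog (Additive.ofMul x) (σ⁻¹ • w) := by
  obtain ⟨y, rfl⟩ := QuotientGroup.mk_surjective x
  have h : conj σ (y : UnitsModTorsion K) = ((Units.map
    (RingOfIntegers.mapRingHom (σ : K →+* K) : 𝓞 K →* 𝓞 K) y : (𝓞 K)ˣ) : UnitsModTorsion K) := rfl
  rw [h, fullLog_mk, fullLog_mk, mult_smul]
  rfl

lemma l1_fullLog_conj (σ : K ≃ₐ[ℚ] K) (x : UnitsModTorsion K) :
    l1 (fullLog (Additive.ofMul (conj σ x))) = l1 (fullLog (Additive.ofMul x)) := by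
  unfold l1
  simp_rw [fullLog_conj]
  exact (MulAction.bijective σ⁻¹).sum_comp (fun w => |fullLog (Additive.ofMul x) w|)

lemma exists_smul_infinitePlace_eq [IsGalois ℚ K] (w₀ w : InfinitePlace K) :
    ∃ σ : K ≃ₐ[ℚ] K, σ • w₀ = w :=
  InfinitePlace.exists_smul_eq_of_comap_eq (Subsingleton.elim _ _)

lemma unitRank_eq : unitRank K = Fintype.card (InfinitePlace K) - 1 :=
  Units.finrank_modTorsion K

end LogMap

/-! ### Ranks of subgroups up to torsion quotients -/

section Rank

variable {G : Type*} [CommGroup G]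

lemma finrank_additive_subgroup (A : Subgroup G) :
    finrank ℤ (Additive A) = finrank ℤ (AddSubgroup.toIntSubmodule A.toAddSubgroup) :=
  LinearEquiv.finrank_eq <| AddEquiv.toIntLinearEquiv
    { toFun := fun x => ⟨Additive.ofMul (x.toMul : G), x.toMul.2⟩
      invFun := fun x => Additive.ofMul ⟨x.1.toMul, x.2⟩
      left_inv := fun _ => rfl
      right_inv := fun _ => rfl
      map_add' := fun _ _ => rfl }

/-- The quotient B/A is torsion, so it has rank zero. -/
lemma finrank_additive_eq_of_exists_pow_mem [Module.Finite ℤ (Additive G)]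
    {A B : Subgroup G} (hAB : A ≤ B) (hB : ∀ y ∈ B, ∃ m : ℕ, m ≠ 0 ∧ y ^ m ∈ A) :
    finrank ℤ (Additive A) = finrank ℤ (Additive B) := by
  rw [finrank_additive_subgroup, finrank_additive_subgroup]
  set A' := AddSubgroup.toIntSubmodule A.toAddSubgroup
  set B' := AddSubgroup.toIntSubmodule B.toAddSubgroup
  have hle : A' ≤ B' := fun x hx => hAB hx
  have h0 : finrank ℤ (B' ⧸ A'.submoduleOf B') = 0 := by
    rw [finrank_eq_zero_iff]
    intro x
    obtain ⟨⟨y, hy⟩, rfl⟩ := Submodule.Quotient.mk_surjective _ x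
    obtain ⟨m, hm, hym⟩ := hB y.toMul hy
    refine ⟨m, by exact_mod_cast hm, ?_⟩
    rw [← Submodule.Quotient.mk_smul, Submodule.Quotient.mk_eq_zero, Submodule.submoduleOf,
      Submodule.mem_comap, Submodule.subtype_apply]
    have : (((m : ℤ) • (⟨y, hy⟩ : B') : B') : Additive G) = Additive.ofMul (y.toMul ^ m) := by
      simp
    rw [this]
    exact hym
  have h1 := (A'.submoduleOf B').finrank_quotient_add_finrank
  rw [h0, zero_add, (Submodule.submoduleOfEquivOfLe hle).finrank_eq] at h1
  exact h1

lemma exists_pow_mem_of_finrank_le [Module.Finite ℤ (Additive G)] {A : Subgroup G}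
    (h : finrank ℤ (Additive G) ≤ finrank ℤ (Additive A)) (y : G) :
    ∃ m : ℕ, m ≠ 0 ∧ y ^ m ∈ A := by
  rw [finrank_additive_subgroup] at h
  set A' := AddSubgroup.toIntSubmodule A.toAddSubgroup
  have h1 := A'.finrank_quotient_add_finrank
  have h0 : finrank ℤ (Additive G ⧸ A') = 0 := by omega
  obtain ⟨a, ha, hay⟩ := finrank_eq_zero_iff.mp h0 (Submodule.Quotient.mk (Additive.ofMul y))
  rw [← Submodule.Quotient.mk_smul, Submodule.Quotient.mk_eq_zero] at hay
  have hz : y ^ a ∈ A := hay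
  refine ⟨a.natAbs, by simpa using ha, ?_⟩
  rcases Int.natAbs_eq a with h | h
  · rw [h, zpow_natCast] at hz
    exact hz
  · rw [h, zpow_neg, zpow_natCast, inv_mem_iff] at hz
    exact hz

lemma finrank_ker_add_finrank_range {H : Type*} [CommGroup H] [Module.Finite ℤ (Additive G)]
    [Module.Finite ℤ (Additive H)] (f : G →* H) (hf : ∀ y, ∃ m : ℕ, m ≠ 0 ∧ y ^ m ∈ f.range) :
    finrank ℤ (Additive f.ker) + finrank ℤ (Additive H) = finrank ℤ (Additive G) := by
  let F : Additive G →ₗ[ℤ] Additive H := f.toAdditive.toIntLinearMap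
  have hrange : F.range = AddSubgroup.toIntSubmodule f.range.toAddSubgroup := by ext; rfl
  have htop : AddSubgroup.toIntSubmodule (⊤ : Subgroup H).toAddSubgroup = ⊤ := by ext; simp
  have h1 : finrank ℤ F.range = finrank ℤ (Additive H) := by
    have h : finrank ℤ (Additive f.range) = finrank ℤ (Additive (⊤ : Subgroup H)) :=
      finrank_additive_eq_of_exists_pow_mem le_top fun y _ => hf y
    rw [finrank_additive_subgroup, finrank_additive_subgroup, htop, finrank_top, ← hrange] at h
    exact h
  have hker : F.ker = AddSubgroup.toIntSubmodule f.ker.toAddSubgroup := by ext; rfl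
  have h2 : finrank ℤ F.ker = finrank ℤ (Additive f.ker) := by
    rw [hker, ← finrank_additive_subgroup]
  have h3 := F.ker.finrank_quotient_add_finrank
  rw [F.quotKerEquivRange.finrank_eq, h1, h2] at h3
  omega

end Rank

/-! ### Minkowski units of small height -/

section Minkowski

variable {K : Type*} [Field K] [NumberField K]

lemma conj_mem_conjSubgroup (σ : K ≃ₐ[ℚ] K) (x : UnitsModTorsion K) :
    conj σ x ∈ conjSubgroup x := Subgroup.subset_closure ⟨σ, rfl⟩

/-- The logarithms of a ℤ-basis of A span over ℝ the logarithms of all of A, so the dimension of the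
hyperplane is at most the rank of A. -/
lemma unitRank_le_finrank_of_le_span {A : Subgroup (UnitsModTorsion K)}
    {v : InfinitePlace K → UnitsModTorsion K} (hv : ∀ w, v w ∈ A)
    (hspan : sumZero (InfinitePlace K) ≤
      Submodule.span ℝ (Set.range fun w => fullLog (Additive.ofMul (v w)))) :
    unitRank K ≤ finrank ℤ (Additive A) := by
  rw [finrank_additive_subgroup, unitRank_eq, ← finrank_sumZero]
  set A' := AddSubgroup.toIntSubmodule A.toAddSubgroup
  let b := finBasis ℤ A'
  have hle : sumZero (InfinitePlace K) ≤
      Submodule.span ℝ (Set.range fun i => fullLog (b i : Additive (UnitsModTorsion K))) := by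
    refine hspan.trans (Submodule.span_le.mpr ?_)
    rintro _ ⟨w, rfl⟩
    have hw : Additive.ofMul (v w) =
        A'.subtype (∑ i, b.repr ⟨Additive.ofMul (v w), hv w⟩ i • b i) := by
      rw [b.sum_repr]; rfl
    rw [SetLike.mem_coe]
    change fullLog (Additive.ofMul (v w)) ∈ _
    rw [hw, map_sum, map_sum]
    refine Submodule.sum_mem _ fun j _ => ?_
    rw [map_zsmul, map_zsmul]
    exact zsmul_mem (Submodule.subset_span (Set.mem_range_self j)) _
  calc finrank ℝ (sumZero (InfinitePlace K)) ≤ _ := Submodule.finrank_mono hle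
    _ ≤ Fintype.card (Fin (finrank ℤ A')) := finrank_range_le_card _
    _ = finrank ℤ A' := Fintype.card_fin _

lemma sum_l1_fullLog_pos {ι : Type*} [Fintype ι] (hr : 0 < unitRank K)
    (η : Basis ι ℤ (Additive (UnitsModTorsion K))) : 0 < ∑ j, l1 (fullLog (η j)) := by
  refine lt_of_le_of_ne (Finset.sum_nonneg fun j _ => l1_nonneg _) fun h => ?_
  have h0 := (Finset.sum_eq_zero_iff_of_nonneg fun j _ => l1_nonneg _).mp h.symm
  have hbot : sumZero (InfinitePlace K) = ⊥ := by
    rw [eq_bot_iff]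
    intro e he
    obtain ⟨t, rfl⟩ := exists_sum_smul_fullLog η he
    rw [Submodule.mem_bot]
    exact Finset.sum_eq_zero fun j hj => by rw [l1_eq_zero (h0 j hj), smul_zero]
  have := finrank_sumZero (W := InfinitePlace K)
  rw [hbot, finrank_bot, ← unitRank_eq] at this
  omega

/-- In a Galois number field there is a Minkowski unit whose height is at most twice the sum of the
heights of the members of a given basis; heights are measured by the `ℓ¹` norm of logarithms. -/
lemma exists_minkowski_unit [IsGalois ℚ K] {ι : Type*} [Fintype ι] (hr : 0 < unitRank K)
    (η : Basis ι ℤ (Additive (UnitsModTorsion K))) :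
    ∃ β : UnitsModTorsion K, l1 (fullLog (Additive.ofMul β)) ≤ 2 * ∑ j, l1 (fullLog (η j)) ∧
      ∀ y, ∃ m : ℕ, m ≠ 0 ∧ y ^ m ∈ conjSubgroup β := by
  classical
  obtain ⟨w₀⟩ : Nonempty (InfinitePlace K) := inferInstance
  set S := ∑ j, l1 (fullLog (η j)) with hS
  have hSpos : 0 < S := sum_l1_fullLog_pos hr η
  -- Dominance needs c > S/2, while the height bound needs S/2 + 2c ≤ 2S; 3/4 S is the largest
  -- choice allowed.
  set c : ℝ := 3 / 4 * S
  have hc : 0 < c := by positivity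
  set e : InfinitePlace K → InfinitePlace K → ℝ := fun w =>
    c • (Pi.single w 1 : InfinitePlace K → ℝ) - fun _ => c / Fintype.card (InfinitePlace K)
  have he : e w₀ ∈ sumZero (InfinitePlace K) := by
    have : (Fintype.card (InfinitePlace K) : ℝ) ≠ 0 := by exact_mod_cast Fintype.card_ne_zero
    rw [mem_sumZero]
    simp [e, Pi.single_apply]
    field_simp
    ring
  obtain ⟨t, ht⟩ := exists_sum_smul_fullLog η he
  let b : Additive (UnitsModTorsion K) := ∑ j, round (t j) • η j
  have herr : l1 (fullLog b - e w₀) ≤ S / 2 := by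
    have h1 : fullLog b - e w₀ = ∑ j, ((round (t j) : ℝ) - t j) • fullLog (η j) := by
      rw [← ht, map_sum, ← Finset.sum_sub_distrib]
      refine Finset.sum_congr rfl fun j _ => ?_
      rw [map_zsmul, sub_smul, Int.cast_smul_eq_zsmul]
    rw [h1, hS, Finset.sum_div]
    refine (l1_sum_le _ _).trans (Finset.sum_le_sum fun j _ => ?_)
    rw [l1_smul, abs_sub_comm]
    have := abs_sub_round (t j)
    nlinarith [l1_nonneg (fullLog (η j))]
  choose σ hσ using exists_smul_infinitePlace_eq w₀
  refine ⟨b.toMul, ?_, fun y => ?_⟩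
  · have h1 := l1_add_le (fullLog b - e w₀) (e w₀)
    have h2 : l1 (e w₀) ≤ 2 * c := l1_target hc w₀
    rw [sub_add_cancel] at h1
    change l1 (fullLog b) ≤ _
    simp only [c] at h2
    linarith
  · refine exists_pow_mem_of_finrank_le (unitRank_le_finrank_of_le_span
      (v := fun w => conj (σ w) b.toMul) (fun w => conj_mem_conjSubgroup _ _) ?_) y
    refine sumZero_le_span_of_l1_lt (c := c) (ε := S / 2) (by simp only [c]; linarith) hc _
      (fun w => fullLog_mem_sumZero _) fun w => ?_
    refine le_trans (le_of_eq ?_) herr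
    unfold l1
    -- Conjugation by σ w permutes coordinates and carries the spike at w₀ to the spike at w, so the
    -- error norm is unchanged.
    rw [← (MulAction.bijective (σ w)⁻¹).sum_comp (fun u => |(fullLog b - e w₀) u|)]
    refine Finset.sum_congr rfl fun u _ => ?_
    have hu : (σ w)⁻¹ • u = w₀ ↔ u = w := by
      rw [inv_smul_eq_iff, hσ]
    simp only [Pi.sub_apply, fullLog_conj, e, Pi.smul_apply, Pi.single_apply, hu]
    rfl

end Minkowski

/-! ### Projection to the relative units -/

section Relative

variable {k l : Type*} [Field k] [Field l] [NumberField k] [NumberField l] [Algebra k l]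

variable (k l) in
/-- The homomorphism `F_k → F_l` induced by the inclusion. -/
noncomputable def inclModTorsion : UnitsModTorsion k →* UnitsModTorsion l :=
  QuotientGroup.map _ _ (Units.map (algebraMap (𝓞 k) (𝓞 l) : 𝓞 k →* 𝓞 l)) (torsion_le_comap _)

lemma normModTorsion_inclModTorsion (y : UnitsModTorsion k) :
    normModTorsion k l (inclModTorsion k l y) = y ^ finrank k l := by
  obtain ⟨u, rfl⟩ := QuotientGroup.mk_surjective y
  have h : Units.map (RingOfIntegers.norm k : 𝓞 l →* 𝓞 k)
      (Units.map (algebraMap (𝓞 k) (𝓞 l) : 𝓞 k →* 𝓞 l) u) = u ^ finrank k l := by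
    ext1
    simpa using RingOfIntegers.norm_algebraMap k (L := l) (u : 𝓞 k)
  exact congrArg (QuotientGroup.mk (s := Units.torsion k)) h

/-- The norm is the [l:k]-th power on units of k, so its cokernel is torsion and rank-nullity
applies. -/
lemma relativeUnitRank_eq : relativeUnitRank k l = unitRank l - unitRank k := by
  have hn : finrank k l ≠ 0 := finrank_pos.ne'
  have h := finrank_ker_add_finrank_range (normModTorsion k l) fun y =>
    ⟨finrank k l, hn, inclModTorsion k l y, normModTorsion_inclModTorsion y⟩
  exact Nat.eq_sub_of_add_eq h

/-- Since k is normal, σ restricts to k, and the norm is compatible with this pair of automorphisms.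
-/
lemma inclModTorsion_normModTorsion_conj [IsGalois ℚ k] (σ : l ≃ₐ[ℚ] l) (x : UnitsModTorsion l) :
    inclModTorsion k l (normModTorsion k l (conj σ x)) =
      conj σ (inclModTorsion k l (normModTorsion k l x)) := by
  obtain ⟨u, rfl⟩ := QuotientGroup.mk_surjective x
  have hcomp : RingHom.comp (algebraMap k l) (σ.restrictNormal k).toRingEquiv =
      RingHom.comp (σ.toRingEquiv : l →+* l) (algebraMap k l) :=
    RingHom.ext fun y => σ.restrictNormal_commutes k y
  have hnorm : algebraMap k l (Algebra.norm k (σ (u : l))) =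
      σ (algebraMap k l (Algebra.norm k (u : l))) := by
    rw [Algebra.norm_eq_of_equiv_equiv _ _ hcomp (u : l), ← σ.restrictNormal_commutes k]
    congr 1
    exact ((σ.restrictNormal k).apply_symm_apply _).symm
  refine congrArg (QuotientGroup.mk (s := Units.torsion l)) (Units.ext (RingOfIntegers.ext ?_))
  exact hnorm

lemma inclModTorsion_normModTorsion [IsGalois k l] (x : UnitsModTorsion l) :
    inclModTorsion k l (normModTorsion k l x) =
      ∏ τ : l ≃ₐ[k] l, conj (τ.restrictScalars ℚ) x := by
  obtain ⟨u, rfl⟩ := QuotientGroup.mk_surjective x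
  have h : Units.map (algebraMap (𝓞 k) (𝓞 l) : 𝓞 k →* 𝓞 l)
      (Units.map (RingOfIntegers.norm k : 𝓞 l →* 𝓞 k) u) = ∏ τ : l ≃ₐ[k] l, Units.map
        (RingOfIntegers.mapRingHom (τ.restrictScalars ℚ : l →+* l) : 𝓞 l →* 𝓞 l) u := by
    refine Units.ext (RingOfIntegers.ext ?_)
    rw [_root_.Units.coe_prod]
    refine Eq.trans ?_ (map_prod (algebraMap (𝓞 l) l) _ _).symm
    exact Algebra.norm_eq_prod_automorphisms k (u : l)
  refine (congrArg (QuotientGroup.mk' (Units.torsion l)) h).trans ?_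
  rw [map_prod]
  rfl

variable (k l) in
/-- The map `x ↦ x ^ [l : k] / norm x` from `F_l` to the relative units. -/
noncomputable def toRelativeUnit : UnitsModTorsion l →* UnitsModTorsion l :=
  powMonoidHom (finrank k l) / (inclModTorsion k l).comp (normModTorsion k l)

lemma toRelativeUnit_apply (x : UnitsModTorsion l) : toRelativeUnit k l x =
    x ^ finrank k l / inclModTorsion k l (normModTorsion k l x) := rfl

lemma toRelativeUnit_mem (x : UnitsModTorsion l) : toRelativeUnit k l x ∈ relativeUnits k l := by
  rw [relativeUnits, MonoidHom.mem_ker, toRelativeUnit_apply, map_div, map_pow,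
    normModTorsion_inclModTorsion, div_self']

lemma toRelativeUnit_of_mem {x : UnitsModTorsion l} (hx : x ∈ relativeUnits k l) :
    toRelativeUnit k l x = x ^ finrank k l := by
  rw [toRelativeUnit_apply, MonoidHom.mem_ker.mp hx, map_one, div_one]

lemma toRelativeUnit_conj [IsGalois ℚ k] (σ : l ≃ₐ[ℚ] l) (x : UnitsModTorsion l) :
    toRelativeUnit k l (conj σ x) = conj σ (toRelativeUnit k l x) := by
  rw [toRelativeUnit_apply, toRelativeUnit_apply, inclModTorsion_normModTorsion_conj, map_div,
    map_pow]

lemma map_toRelativeUnit_conjSubgroup [IsGalois ℚ k] (x : UnitsModTorsion l) :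
    (conjSubgroup x).map (toRelativeUnit k l) = conjSubgroup (toRelativeUnit k l x) := by
  unfold conjSubgroup
  rw [MonoidHom.map_closure, ← Set.range_comp]
  simp only [Function.comp_def, toRelativeUnit_conj]

lemma isRelativeMinkowskiUnit_toRelativeUnit [IsGalois ℚ k] {β : UnitsModTorsion l}
    (hβ : ∀ y, ∃ m : ℕ, m ≠ 0 ∧ y ^ m ∈ conjSubgroup β) :
    IsRelativeMinkowskiUnit k (toRelativeUnit k l β) := by
  refine ⟨toRelativeUnit_mem β, finrank_additive_eq_of_exists_pow_mem ?_ fun y hy => ?_⟩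
  · rw [← map_toRelativeUnit_conjSubgroup]
    rintro _ ⟨x, -, rfl⟩
    exact toRelativeUnit_mem x
  · obtain ⟨m, hm, hym⟩ := hβ y
    -- For a relative unit y, the power y^([l:k] m) is the image of y^m, which is generated by
    -- conjugates of β.
    refine ⟨finrank k l * m, mul_ne_zero finrank_pos.ne' hm, ?_⟩
    rw [pow_mul, ← toRelativeUnit_of_mem hy, ← map_pow, ← map_toRelativeUnit_conjSubgroup]
    exact Subgroup.mem_map_of_mem _ hym

lemma l1_fullLog_toRelativeUnit_le [IsGalois k l] (x : UnitsModTorsion l) :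
    l1 (fullLog (Additive.ofMul (toRelativeUnit k l x))) ≤
      2 * ((finrank k l : ℝ) - 1) * l1 (fullLog (Additive.ofMul x)) := by
  classical
  have hcard : Fintype.card (l ≃ₐ[k] l) = finrank k l := by
    rw [← IsGalois.card_aut_eq_finrank k l, Nat.card_eq_fintype_card]
  have h1 : toRelativeUnit k l x = ∏ τ : l ≃ₐ[k] l, x / conj (τ.restrictScalars ℚ) x := by
    rw [toRelativeUnit_apply, inclModTorsion_normModTorsion, Finset.prod_div_distrib,
      Finset.prod_const, Finset.card_univ, hcard]
  have hone : conj ((1 : l ≃ₐ[k] l).restrictScalars ℚ) x = x := by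
    obtain ⟨u, rfl⟩ := QuotientGroup.mk_surjective x
    rfl
  -- The factor at τ = 1 is trivial; this is where [l:k] − 1 replaces [l:k].
  rw [h1, ← Finset.mul_prod_erase _ _ (Finset.mem_univ 1), hone, div_self', one_mul, ofMul_prod,
    map_sum]
  calc _ ≤ ∑ τ ∈ Finset.univ.erase (1 : l ≃ₐ[k] l),
        l1 (fullLog (Additive.ofMul (x / conj (τ.restrictScalars ℚ) x))) := l1_sum_le _ _
    _ ≤ ∑ τ ∈ Finset.univ.erase (1 : l ≃ₐ[k] l), 2 * l1 (fullLog (Additive.ofMul x)) :=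
        Finset.sum_le_sum fun τ _ => by
          rw [ofMul_div, map_sub]
          refine (l1_sub_le _ _).trans ?_
          rw [l1_fullLog_conj, two_mul]
    _ = _ := by
        rw [Finset.sum_const, Finset.card_erase_of_mem (Finset.mem_univ _), Finset.card_univ, hcard,
          nsmul_eq_mul, Nat.cast_sub finrank_pos, Nat.cast_one]
        ring

/-- The bound `4 ([l : k] - 1) ∑ h(η_j)` for a relative Minkowski unit, valid for real and complex
fields alike. -/
lemma exists_relativeMinkowskiUnit [IsGalois ℚ k] [IsGalois ℚ l] {ι : Type*} [Fintype ι]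
    (hr : 0 < unitRank l) (η : Basis ι ℤ (Additive (UnitsModTorsion l))) :
    ∃ γ : UnitsModTorsion l, IsRelativeMinkowskiUnit k γ ∧
      height γ ≤ 4 * ((finrank k l : ℝ) - 1) * ∑ j, height (η j).toMul := by
  have : IsGalois k l := IsGalois.tower_top_of_isGalois ℚ k l
  obtain ⟨β, hβ, hgen⟩ := exists_minkowski_unit hr η
  refine ⟨toRelativeUnit k l β, isRelativeMinkowskiUnit_toRelativeUnit hgen, ?_⟩
  have hd : (0 : ℝ) < 2 * finrank ℚ l := by
    have : (0 : ℝ) < finrank ℚ l := by exact_mod_cast finrank_pos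
    positivity
  have hn : (0 : ℝ) ≤ 2 * ((finrank k l : ℝ) - 1) := by
    have : (1 : ℝ) ≤ finrank k l := by exact_mod_cast finrank_pos
    linarith
  have hsum : ∑ j, l1 (fullLog (η j)) = 2 * finrank ℚ l * ∑ j, height (η j).toMul := by
    rw [Finset.mul_sum]
    exact Finset.sum_congr rfl fun j _ => (two_mul_height _).symm
  refine le_of_mul_le_mul_left ?_ hd
  calc _ = l1 (fullLog (Additive.ofMul (toRelativeUnit k l β))) := two_mul_height _
    _ ≤ 2 * ((finrank k l : ℝ) - 1) * l1 (fullLog (Additive.ofMul β)) :=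
        l1_fullLog_toRelativeUnit_le β
    _ ≤ 2 * ((finrank k l : ℝ) - 1) * (2 * ∑ j, l1 (fullLog (η j))) :=
        mul_le_mul_of_nonneg_left hβ hn
    _ = _ := by rw [hsum]; ring

end Relative

end RelativeUnits

theorem theorem1p2 {k l : Type*} [Field k] [Field l] [NumberField k] [NumberField l]
    [Algebra k l] [IsGalois ℚ k] [IsGalois ℚ l]
    (hk : 1 ≤ RelativeUnits.unitRank k)
    (hkl : RelativeUnits.unitRank k < RelativeUnits.unitRank l)
    (η : Module.Basis (Fin (RelativeUnits.unitRank l)) ℤ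
      (Additive (RelativeUnits.UnitsModTorsion l))) :
    RelativeUnits.relativeUnitRank k l = RelativeUnits.unitRank l - RelativeUnits.unitRank k ∧
    (NumberField.IsTotallyReal l →
      ∃ γ : RelativeUnits.UnitsModTorsion l, RelativeUnits.IsRelativeMinkowskiUnit k γ ∧
        RelativeUnits.height γ ≤
          4 * ((Module.finrank k l : ℝ) - 1) * ∑ j, RelativeUnits.height (η j).toMul) ∧
    (NumberField.IsTotallyComplex l →
      ∃ γ : RelativeUnits.UnitsModTorsion l, RelativeUnits.IsRelativeMinkowskiUnit k γ ∧
        RelativeUnits.height γ ≤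
          8 * ((Module.finrank k l : ℝ) - 1) * ∑ j, RelativeUnits.height (η j).toMul) := by
  have hr : 0 < RelativeUnits.unitRank l := by omega
  obtain ⟨γ, hγ, hle⟩ := RelativeUnits.exists_relativeMinkowskiUnit (k := k) hr η
  refine ⟨RelativeUnits.relativeUnitRank_eq, fun _ => ⟨γ, hγ, hle⟩, fun _ => ⟨γ, hγ, hle.trans ?_⟩⟩
  have hn : (1 : ℝ) ≤ Module.finrank k l := by
    exact_mod_cast Module.finrank_pos
  have hh : ∀ x : RelativeUnits.UnitsModTorsion l, 0 ≤ RelativeUnits.height x := by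
    intro x
    obtain ⟨y, rfl⟩ := QuotientGroup.mk_surjective x
    exact div_nonneg (Height.zero_le_logHeight₁ _) (Nat.cast_nonneg _)
  have hS : 0 ≤ ∑ j, RelativeUnits.height (η j).toMul := Finset.sum_nonneg fun j _ => hh _
  -- The complex bound follows from the constant 4, as the right-hand side is nonnegative.
  nlinarith [mul_nonneg (sub_nonneg.mpr hn) hS]
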